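/- All graphs are finite and simple (no loops or multiple edges), possibly disconnected or empty, and a homomorphism of graphs is a map of vertex sets (not necessarily injective) that sends edges to edges. Let $\mathrm{FI}$ be the category whose objects are the sets $[n]=\{1,\dots,n\}$, $n\ge 0$, and whose morphisms are the injections. An $\mathrm{FI}$-graph is a functor $G_\bullet$ from $\mathrm{FI}$ to the category of graphs and graph homomorphisms; write $G_n=G_\bullet([n])$, and write $G(f)$ for the homomorphism induced by an injection $f$. The $\mathrm{FI}$-graph $G_\bullet$ is vertex-stable with stable degree $\le d$ if for every $n\ge d$ and every vertex $v\in V(G_{n+1})$ there are a vertex $w\in V(G_n)$ and an injection $f:[n]\hookrightarrow[n+1]$ with $G(f)(w)=v$. For graphs $G$ and $H$, let $\eta_H(G)$ be the number of subgraphs of $G$ that are isomorphic to $H$, and let $\eta_H^{\mathrm{ind}}(G)$ be the number of induced subgraphs of $G$ that are isomorphic to $H$. **Theorem.** Let $d\ge 0$ and let $G_\bullet$ be a vertex-stable $\mathrm{FI}$-graph with stable degree $\le d$. Then for every graph $H$ there exist polynomials $p_H(X),\,p_H^{\mathrm{ind}}(X)\in\mathbb{Q}[X]$ of degree $\le d\cdot|V(H)|$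 such that for all sufficiently large $n$, $$p_H(n)=\eta_H(G_n)\qquad\text{and}\qquad p_H^{\mathrm{ind}}(n)=\eta_H^{\mathrm{ind}}(G_n).$$ -/

import Mathlib

open CategoryTheory

universe u v

/-- The category `FI`: its objects are the finite sets `[n]`, for `n : ℕ`, and its morphisms are
the injections. The set `[n]` is modelled by `Fin n`. -/
structure FI : Type where
  /-- the object `[n]` -/
  of ::
  /-- the number of elements of `[n]` -/
  size : ℕ

instance FI.instCategory : Category.{0} FI where
  Hom a b := Fin a.size ↪ Fin b.size
  id a := Function.Embedding.refl (Fin a.size)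
  comp f g := f.trans g

/-- The objects of the category of graphs: finite simple graphs (no loops, no multiple edges; the
graph may be disconnected, and may be empty). -/
structure FinGraph : Type (u + 1) where
  /-- the set of vertices -/
  V : Type u
  [fintypeV : Fintype V]
  /-- the graph on these vertices -/
  graph : SimpleGraph V

attribute [instance] FinGraph.fintypeV

/-- The morphisms of the category of graphs are the graph homomorphisms: maps of vertices that send
edges to edges. They need not be injective. -/
instance FinGraph.instCategory : Category.{u} FinGraph.{u} where
  Hom G G' := G.graph →g G'.graph
  id _ := SimpleGraph.Hom.id
  comp φ ψ := ψ.comp φ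

/-- An `FI`-graph: a functor from `FI` to the category of finite simple graphs. -/
abbrev FIGraph : Type (u + 1) := FI ⥤ FinGraph.{u}

namespace FIGraph

/-- The finite graph `G_n`, the value of the `FI`-graph `G` at `[n]`. -/
abbrev eval (G : FIGraph.{u}) (n : ℕ) : FinGraph.{u} := G.obj (FI.of n)

/-- The transition map `G(f) : G_m → G_n` induced by an injection `f : [m] ↪ [n]`. -/
def transition (G : FIGraph.{u}) {m n : ℕ} (f : Fin m ↪ Fin n) :
    (G.eval m).graph →g (G.eval n).graph :=
  G.map (X := FI.of m) (Y := FI.of n) f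

/-- `G` is vertex-stable with stable degree `≤ d`: for all `n ≥ d`, every vertex of `G_{n+1}` is the
image of a vertex of `G_n` under some transition map. -/
def IsVertexStable (G : FIGraph.{u}) (d : ℕ) : Prop :=
  ∀ n : ℕ, d ≤ n → ∀ v : (G.eval (n + 1)).V,
    ∃ (w : (G.eval n).V) (f : Fin n ↪ Fin (n + 1)), G.transition f w = v

end FIGraph

/-- The number of induced subgraphs of `G` that are isomorphic to `H`. (The number of all subgraphs
of `G` that are isomorphic to `H` is `SimpleGraph.copyCount`.) -/
noncomputable def SimpleGraph.inducedCopyCount {V : Type u} {W : Type v}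
    (G : SimpleGraph V) (H : SimpleGraph W) : ℕ :=
  {G' : G.Subgraph | G'.IsInduced ∧ Nonempty (H ≃g G'.coe)}.ncard

/-!
Every vertex of `G_n`, `n ≥ d`, is the image of a vertex `a` of `G_d` under an injection
`f : [d] ↪ [n]`, so the vertices of `G_n` are represented by the pairs `(a, f)`
(`FIGraph.IsVertexStable.exists_transition_eq`). Equality and adjacency of the represented vertices
are relations between pairs `(a, f)` and `(b, g)` that are preserved by transition maps. Applied to
permutations, this says that they depend only on `a`, `b` and the set of `(i, j)` with `f i = g j`;
applied to inclusions, that each of these finitely many types is eventually always or eventually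
never related. Hence for large `n` both relations are given by a rule independent of `n`
(`exists_eventually_iff_coincidences`).

Labelled copies of `H` are maps from the vertices of `H` to those of `G_n` subject to conditions on
equalities and adjacencies. Such a map is counted by its lifts to families of pairs `(a, f)`, each
weighted by the inverse of the number of lifts (`Nat.card_subtype_eq_sum_lifts`). For large `n`, the
weights depend only on the labels `a`, and both they and the numbers of families with prescribed
coincidences are rational functions of `n`, because the functions into `[n]` with a given kernel are
counted by a falling factorial. So the count is eventually a rational function of `n`
(`IsEventuallyRational.card_maps`), and dividing by the number of automorphisms of `H` gives the
count of (induced) subgraphs.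

A rational function with integer values at all large integers is a polynomial
(`IsEventuallyRational.exists_polynomial`), and its degree is at most `d * |V(H)|` because `G_n` has
at most `|V(G_d)| * n ^ d` vertices.
-/

/-! ### Eventually rational functions -/

/-- The function `f` agrees, for all large `n`, with a quotient of two polynomials. -/
def IsEventuallyRational (f : ℕ → ℚ) : Prop :=
  ∃ p q : Polynomial ℚ, q ≠ 0 ∧ ∀ᶠ n : ℕ in Filter.atTop, f n = p.eval (n : ℚ) / q.eval (n : ℚ)

theorem Polynomial.eventually_eval_natCast_ne_zero {q : Polynomial ℚ} (hq : q ≠ 0) :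
    ∀ᶠ n : ℕ in Filter.atTop, q.eval (n : ℚ) ≠ 0 :=
  tendsto_natCast_atTop_atTop.eventually (q.eventually_atTop_not_isRoot hq)

namespace IsEventuallyRational

variable {f g : ℕ → ℚ}

theorem congr (hf : IsEventuallyRational f) (h : ∀ᶠ n in Filter.atTop, g n = f n) :
    IsEventuallyRational g := by
  obtain ⟨p, q, hq, hf⟩ := hf
  exact ⟨p, q, hq, by filter_upwards [h, hf] with n h₁ h₂ using h₁.trans h₂⟩

theorem of_polynomial (p : Polynomial ℚ) : IsEventuallyRational fun n ↦ p.eval (n : ℚ) :=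
  ⟨p, 1, one_ne_zero, by simp⟩

theorem const (c : ℚ) : IsEventuallyRational fun _ ↦ c := by
  simpa using of_polynomial (Polynomial.C c)

theorem add (hf : IsEventuallyRational f) (hg : IsEventuallyRational g) :
    IsEventuallyRational fun n ↦ f n + g n := by
  obtain ⟨p, q, hq, hf⟩ := hf
  obtain ⟨p', q', hq', hg⟩ := hg
  refine ⟨p * q' + q * p', q * q', mul_ne_zero hq hq', ?_⟩
  filter_upwards [hf, hg, Polynomial.eventually_eval_natCast_ne_zero hq,
    Polynomial.eventually_eval_natCast_ne_zero hq'] with n h₁ h₂ h₃ h₄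
  rw [h₁, h₂, div_add_div _ _ h₃ h₄]
  simp

theorem mul (hf : IsEventuallyRational f) (hg : IsEventuallyRational g) :
    IsEventuallyRational fun n ↦ f n * g n := by
  obtain ⟨p, q, hq, hf⟩ := hf
  obtain ⟨p', q', hq', hg⟩ := hg
  refine ⟨p * p', q * q', mul_ne_zero hq hq', ?_⟩
  filter_upwards [hf, hg] with n h₁ h₂
  rw [h₁, h₂, div_mul_div_comm]
  simp

theorem inv (hf : IsEventuallyRational f) : IsEventuallyRational fun n ↦ (f n)⁻¹ := by
  obtain ⟨p, q, hq, hf⟩ := hf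
  by_cases hp : p = 0
  · exact (const 0).congr (by filter_upwards [hf] with n h; simp [h, hp])
  · exact ⟨q, p, hp, by filter_upwards [hf] with n h; rw [h, inv_div]⟩

theorem sum {ι : Type*} (s : Finset ι) {f : ι → ℕ → ℚ}
    (hf : ∀ i ∈ s, IsEventuallyRational (f i)) :
    IsEventuallyRational fun n ↦ ∑ i ∈ s, f i n := by
  classical
  induction s using Finset.induction_on with
  | empty => simpa using const 0
  | insert a s ha ih =>
    simp only [Finset.sum_insert ha]
    exact (hf a (by simp)).add (ih fun i hi ↦ hf i (by simp [hi]))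

theorem prod {ι : Type*} (s : Finset ι) {f : ι → ℕ → ℚ}
    (hf : ∀ i ∈ s, IsEventuallyRational (f i)) :
    IsEventuallyRational fun n ↦ ∏ i ∈ s, f i n := by
  classical
  induction s using Finset.induction_on with
  | empty => simpa using const 1
  | insert a s ha ih =>
    simp only [Finset.prod_insert ha]
    exact (hf a (by simp)).mul (ih fun i hi ↦ hf i (by simp [hi]))

theorem descFactorial (k : ℕ) : IsEventuallyRational fun n ↦ (n.descFactorial k : ℚ) :=
  (of_polynomial (descPochhammer ℚ k)).congr
    (.of_forall fun n ↦ (descPochhammer_eval_eq_descFactorial ℚ n k).symm)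

/-- A rational function that takes integer values at all large integers is a polynomial: after
clearing the denominators of the polynomial part, the proper fraction that remains is an
integer-valued function tending to zero. -/
theorem exists_polynomial {f : ℕ → ℕ} (hf : IsEventuallyRational fun n ↦ (f n : ℚ)) :
    ∃ p : Polynomial ℚ, ∀ᶠ n : ℕ in Filter.atTop, p.eval (n : ℚ) = f n := by
  obtain ⟨p, q, hq, hf⟩ := hf
  obtain ⟨b, hb, hbP⟩ :=
    IsLocalization.integerNormalization_spec (nonZeroDivisors ℤ) (p / q)
  set P := IsLocalization.integerNormalization (nonZeroDivisors ℤ) (p / q)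
  have hb0 : b ≠ 0 := nonZeroDivisors.ne_zero hb
  have hPe (n : ℕ) : ((P.eval (n : ℤ) : ℤ) : ℚ) = b * (p / q).eval (n : ℚ) := by
    have h := congrArg (Polynomial.eval (n : ℚ)) hbP
    rw [Polynomial.eval_smul, Polynomial.eval_natCast_map] at h
    simpa using h
  have hlim : Filter.Tendsto (fun n : ℕ ↦ (b : ℚ) * ((p % q).eval (n : ℚ) / q.eval (n : ℚ)))
      Filter.atTop (nhds 0) := by
    have h := (Polynomial.div_tendsto_atTop_zero_of_degree_lt (p % q) q
      (EuclideanDomain.mod_lt p hq)).comp (tendsto_natCast_atTop_atTop (R := ℚ))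
    simpa using h.const_mul (b : ℚ)
  refine ⟨p / q, ?_⟩
  filter_upwards [hf, Polynomial.eventually_eval_natCast_ne_zero hq,
    hlim.eventually (Metric.ball_mem_nhds (0 : ℚ) one_pos)] with n h₁ h₂ h₃
  have hdiv : p.eval (n : ℚ) = q.eval (n : ℚ) * (p / q).eval (n : ℚ) + (p % q).eval (n : ℚ) := by
    rw [← Polynomial.eval_mul, ← Polynomial.eval_add, EuclideanDomain.div_add_mod]
  have hfrac : (b : ℚ) * ((p % q).eval (n : ℚ) / q.eval (n : ℚ))
      = ((b * f n - P.eval (n : ℤ) : ℤ) : ℚ) := by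
    push_cast
    rw [hPe, h₁, hdiv]
    field_simp
    ring
  have hz : b * (f n : ℤ) - P.eval (n : ℤ) = 0 := by
    rw [hfrac, dist_zero_right, ← Rat.norm_cast_real] at h₃
    rw [← Int.abs_lt_one_iff]
    have h₄ : |((b * f n - P.eval (n : ℤ) : ℤ) : ℝ)| < 1 := by simpa using h₃
    exact_mod_cast h₄
  have h₅ : (b : ℚ) * f n = b * (p / q).eval (n : ℚ) := by
    rw [← hPe]; exact_mod_cast sub_eq_zero.1 hz
  exact (mul_left_cancel₀ (by exact_mod_cast hb0) h₅).symm

end IsEventuallyRational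

/-- A polynomial bounded by a multiple of `n ^ D` at the large integers has degree at most `D`. -/
theorem Polynomial.natDegree_le_of_eventually_abs_eval_le {p : Polynomial ℚ} {D : ℕ} (C : ℚ)
    (h : ∀ᶠ n : ℕ in Filter.atTop, |p.eval (n : ℚ)| ≤ C * (n : ℚ) ^ D) : p.natDegree ≤ D := by
  by_contra! hD
  have hlim := (Polynomial.abs_div_tendsto_atTop_atTop_of_degree_gt p (X ^ D)
    (degree_lt_degree (by rwa [natDegree_X_pow]))
    (pow_ne_zero _ X_ne_zero)).comp (tendsto_natCast_atTop_atTop (R := ℚ))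
  obtain ⟨n, h₁, h₂, h₃⟩ :=
    (h.and ((hlim.eventually_gt_atTop C).and (Filter.eventually_gt_atTop 0))).exists
  have h₄ : (0 : ℚ) < (n : ℚ) ^ D := by positivity
  simp only [Function.comp_apply, eval_pow, eval_X, abs_div, abs_of_pos h₄] at h₂
  exact absurd h₁ (not_le.2 ((lt_div_iff₀ h₄).1 h₂))

/-! ### Counting functions and embeddings by their coincidences -/

/-- Functions with kernel `r` are the embeddings of the quotient by `r`. -/
def Setoid.kerEqEquiv {I J : Type*} (r : Setoid I) :
    {x : I → J // Setoid.ker x = r} ≃ (Quotient r ↪ J) where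
  toFun x := ⟨Quotient.lift x.1 fun i j h ↦ by
    obtain ⟨x, rfl⟩ := x; exact h, by
    obtain ⟨x, rfl⟩ := x
    rintro ⟨i⟩ ⟨j⟩ h
    exact Quotient.sound h⟩
  invFun e := ⟨fun i ↦ e ⟦i⟧, by
    ext i j
    rw [Setoid.ker_def, e.injective.eq_iff, Quotient.eq]⟩
  left_inv _ := rfl
  right_inv e := by
    ext q
    induction q using Quotient.inductionOn
    rfl

/-- The number of functions `I → [n]` whose kernel satisfies a given condition is a sum of falling
factorials of `n`. -/
theorem IsEventuallyRational.card_ker {I : Type*} [Finite I] (C : Setoid I → Prop) :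
    IsEventuallyRational fun n ↦ (Nat.card {x : I → Fin n // C (Setoid.ker x)} : ℚ) := by
  classical
  have := Fintype.ofFinite I
  have : Finite (Setoid I) := Finite.of_injective (fun (r : Setoid I) i j ↦ r i j) fun r s h ↦
    Setoid.ext fun i j ↦ iff_of_eq (congrFun (congrFun h i) j)
  have := Fintype.ofFinite {r : Setoid I // C r}
  have h (n : ℕ) : Nat.card {x : I → Fin n // C (Setoid.ker x)} =
      ∑ r : {r : Setoid I // C r}, n.descFactorial (Nat.card (Quotient r.1)) := by
    let e : {x : I → Fin n // C (Setoid.ker x)} ≃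
        Σ r : {r : Setoid I // C r}, {x : I → Fin n // Setoid.ker x = r.1} :=
      { toFun := fun x ↦ ⟨⟨Setoid.ker x.1, x.2⟩, x.1, rfl⟩
        invFun := fun x ↦ ⟨x.2.1, by rw [x.2.2]; exact x.1.2⟩
        left_inv := fun _ ↦ rfl
        right_inv := by
          rintro ⟨⟨r, hr⟩, x, hx⟩
          obtain rfl : Setoid.ker x = r := hx
          rfl }
    rw [Nat.card_congr e, Nat.card_sigma]
    refine Finset.sum_congr rfl fun r _ ↦ ?_
    rw [Nat.card_congr r.1.kerEqEquiv, Nat.card_eq_fintype_card, Fintype.card_embedding_eq,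
      Fintype.card_fin, Nat.card_eq_fintype_card]
  simp only [h, Nat.cast_sum]
  exact .sum _ fun r _ ↦ .descFactorial _

/-- The number of families of embeddings `[d] ↪ [n]`, indexed by a finite set, subject to a
condition on which of their values coincide. -/
theorem IsEventuallyRational.card_embedding_family {W : Type*} [Finite W] (d : ℕ)
    (C : (W → W → Fin d → Fin d → Prop) → Prop) :
    IsEventuallyRational fun n ↦
      (Nat.card {F : W → (Fin d ↪ Fin n) // C fun w w' i j ↦ F w i = F w' j} : ℚ) := by
  refine (card_ker (I := W × Fin d) fun r ↦ (∀ w i j, r (w, i) (w, j) → i = j) ∧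
    C fun w w' i j ↦ r (w, i) (w', j)).congr (.of_forall fun n ↦ ?_)
  congr 1
  exact Nat.card_congr
    { toFun := fun F ↦ ⟨fun p ↦ F.1 p.1 p.2, fun w i j h ↦ (F.1 w).injective h, F.2⟩
      invFun := fun x ↦ ⟨fun w ↦ ⟨fun i ↦ x.1 (w, i), fun i j h ↦ x.2.1 w i j h⟩, x.2.2⟩
      left_inv := fun _ ↦ rfl
      right_inv := fun _ ↦ rfl }

/-- Two families of elements of a finite type with the same coincidences differ by a
permutation. -/
theorem Equiv.Perm.exists_apply_eq_of_ker_eq {I J : Type*} [Finite J] {x y : I → J}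
    (h : ∀ i j, x i = x j ↔ y i = y j) : ∃ σ : Equiv.Perm J, ∀ i, σ (x i) = y i := by
  classical
  have := Fintype.ofFinite J
  let e : {a // a ∈ Set.range x} ≃ {a // a ∈ Set.range y} := Equiv.ofBijective
    (fun a ↦ ⟨y a.2.choose, Set.mem_range_self _⟩) <| by
      constructor
      · intro a b hab
        have := (h _ _).2 (Subtype.ext_iff.1 hab)
        rw [a.2.choose_spec, b.2.choose_spec] at this
        exact Subtype.ext this
      · rintro ⟨_, i, rfl⟩
        refine ⟨⟨x i, i, rfl⟩, Subtype.ext ((h _ _).1 ?_)⟩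
        exact (⟨x i, i, rfl⟩ : {a // a ∈ Set.range x}).2.choose_spec
  refine ⟨e.extendSubtype, fun i ↦ ?_⟩
  rw [e.extendSubtype_apply_of_mem _ ⟨i, rfl⟩]
  exact (h _ _).1 (⟨x i, i, rfl⟩ : {a // a ∈ Set.range x}).2.choose_spec

theorem Function.Embedding.exists_perm_of_coincidences {d m : ℕ} {f g f' g' : Fin d ↪ Fin m}
    (h : ∀ i j, f i = g j ↔ f' i = g' j) :
    ∃ σ : Equiv.Perm (Fin m), f.trans σ.toEmbedding = f' ∧ g.trans σ.toEmbedding = g' := by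
  obtain ⟨σ, hσ⟩ := Equiv.Perm.exists_apply_eq_of_ker_eq (x := Sum.elim f g)
    (y := Sum.elim f' g') (by
      rintro (i | i) (j | j)
      · simp
      · simpa using h i j
      · simpa [eq_comm] using h j i
      · simp)
  exact ⟨σ, by ext i; simpa using congrArg Fin.val (hσ (.inl i)),
    by ext i; simpa using congrArg Fin.val (hσ (.inr i))⟩

/-- A relation between labelled embeddings `[d] ↪ [n]` that is preserved by the injections
`[m] ↪ [n]` depends, for large `n`, only on the labels and on which values of the two embeddings
coincide: there are finitely many such types, and a type that is related for some `m` is related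
for all larger `n`, as any two realizations of it differ by a permutation. -/
theorem exists_eventually_iff_coincidences {A : Type*} [Finite A] {d : ℕ}
    (R : ∀ n, A → (Fin d ↪ Fin n) → A → (Fin d ↪ Fin n) → Prop)
    (hR : ∀ {m n} (h : Fin m ↪ Fin n) {a f b g},
      R m a f b g → R n a (f.trans h) b (g.trans h)) :
    ∃ S : A → A → (Fin d → Fin d → Prop) → Prop, ∀ᶠ n in Filter.atTop,
      ∀ a f b g, R n a f b g ↔ S a b fun i j ↦ f i = g j := by
  -- `S a b P` says that a type is related for some `m`; the number of types being finite, one bound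
  -- on `n` serves them all.
  let S : A → A → (Fin d → Fin d → Prop) → Prop := fun a b P ↦
    ∃ (m : ℕ) (f g : Fin d ↪ Fin m), (fun i j ↦ f i = g j) = P ∧ R m a f b g
  refine ⟨S, ?_⟩
  have key : ∀ t : A × A × (Fin d → Fin d → Prop), ∀ᶠ n in Filter.atTop, ∀ f g : Fin d ↪ Fin n,
      (fun i j ↦ f i = g j) = t.2.2 → S t.1 t.2.1 t.2.2 → R n t.1 f t.2.1 g := by
    rintro ⟨a, b, P⟩
    by_cases hS : S a b P
    · obtain ⟨m, f, g, hP, hm⟩ := hS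
      filter_upwards [Filter.eventually_ge_atTop m] with n hn f' g' hP' _
      obtain ⟨σ, hf, hg⟩ := Function.Embedding.exists_perm_of_coincidences
        (f := f.trans (Fin.castLEEmb hn)) (g := g.trans (Fin.castLEEmb hn)) (f' := f') (g' := g')
        (fun i j ↦ by simpa using iff_of_eq (congrFun (congrFun (hP.trans hP'.symm) i) j))
      have := hR σ.toEmbedding (hR (Fin.castLEEmb hn) hm)
      rwa [hf, hg] at this
    · exact .of_forall fun n f g _ h ↦ absurd h hS
  filter_upwards [Filter.eventually_all.2 key] with n hn a f b g
  exact ⟨fun h ↦ ⟨n, f, g, rfl, h⟩, fun h ↦ hn (a, b, _) f g rfl h⟩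

/-! ### Counting maps into a quotient -/

/-- Maps `W → V` are counted by their lifts along a surjection `π : P → V`, a lift being weighted
by the inverse of the number of lifts of the same map. -/
theorem Nat.card_subtype_eq_sum_lifts {W P V : Type*} [Fintype W] [Fintype P] [Finite V]
    [DecidableEq W] {π : P → V} (hπ : Function.Surjective π) (Q : (W → V) → Prop)
    [DecidablePred Q] :
    (Nat.card {φ : W → V // Q φ} : ℚ) =
      ∑ ψ : W → P, if Q (π ∘ ψ) then ∏ w, (Nat.card {p // π p = π (ψ w)} : ℚ)⁻¹ else 0 := by
  classical
  have := Fintype.ofFinite V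
  rw [← Finset.sum_fiberwise Finset.univ (fun ψ : W → P ↦ π ∘ ψ), Nat.card_eq_fintype_card,
    Fintype.card_subtype, Finset.card_filter, Nat.cast_sum]
  refine Finset.sum_congr rfl fun φ _ ↦ ?_
  have hlift : ∀ ψ ∈ Finset.univ.filter (fun ψ : W → P ↦ π ∘ ψ = φ),
      (if Q (π ∘ ψ) then ∏ w, (Nat.card {p // π p = π (ψ w)} : ℚ)⁻¹ else 0) =
        if Q φ then ∏ w, (Nat.card {p // π p = φ w} : ℚ)⁻¹ else 0 := by
    intro ψ hψ
    obtain rfl := (Finset.mem_filter.1 hψ).2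
    rfl
  have hcard : (Finset.univ.filter (fun ψ : W → P ↦ π ∘ ψ = φ)).card =
      ∏ w, Nat.card {p // π p = φ w} := by
    rw [← Fintype.card_subtype, ← Nat.card_eq_fintype_card, ← Nat.card_pi]
    exact Nat.card_congr ((Equiv.subtypeEquivRight fun ψ ↦ funext_iff).trans
      (Equiv.subtypePiEquivPi (p := fun w p ↦ π p = φ w)))
  rw [Finset.sum_congr rfl hlift, Finset.sum_const, hcard, nsmul_eq_mul]
  split_ifs
  · rw [Nat.cast_prod, ← Finset.prod_mul_distrib, Finset.prod_eq_one, Nat.cast_one]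
    intro w _
    obtain ⟨p, hp⟩ := hπ (φ w)
    have : Nonempty {p // π p = φ w} := ⟨⟨p, hp⟩⟩
    exact mul_inv_cancel₀ (by exact_mod_cast Nat.card_pos.ne')
  · simp

/-- The number of labelled embeddings in a given relation to `(a, f)`, where the relation depends
only on labels and coincidences, does not depend on `f`; hence it is a quotient of the number of
all related pairs by the number of embeddings. -/
theorem Nat.card_coincidences_eq_div {A : Type*} [Fintype A] {d n : ℕ}
    (S : A → A → (Fin d → Fin d → Prop) → Prop) (a : A) (f : Fin d ↪ Fin n) :
    (Nat.card {p : A × (Fin d ↪ Fin n) // S p.1 a fun i j ↦ p.2 i = f j} : ℚ) =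
      (∑ b, (Nat.card {F : Bool → (Fin d ↪ Fin n) //
        S b a fun i j ↦ F true i = F false j} : ℚ)) * (n.descFactorial d : ℚ)⁻¹ := by
  classical
  let T (b : A) (f : Fin d ↪ Fin n) := {g : Fin d ↪ Fin n // S b a fun i j ↦ g i = f j}
  have hT (b : A) (f' : Fin d ↪ Fin n) : Nat.card (T b f') = Nat.card (T b f) := by
    obtain ⟨σ, hσ, -⟩ := Function.Embedding.exists_perm_of_coincidences
      (f := f') (g := f') (f' := f) (g' := f) (by simp)
    refine Nat.card_congr (Equiv.subtypeEquiv ((Equiv.refl _).embeddingCongr σ) fun g ↦ ?_)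
    simp [← hσ]
  have hpairs (b : A) : Nat.card {F : Bool → (Fin d ↪ Fin n) //
      S b a fun i j ↦ F true i = F false j} = n.descFactorial d * Nat.card (T b f) := by
    have e : {F : Bool → (Fin d ↪ Fin n) // S b a fun i j ↦ F true i = F false j} ≃
        Σ f' : Fin d ↪ Fin n, T b f' :=
      { toFun := fun F ↦ ⟨F.1 false, F.1 true, F.2⟩
        invFun := fun x ↦ ⟨fun c ↦ cond c x.2.1 x.1, x.2.2⟩
        left_inv := fun F ↦ Subtype.ext (funext fun c ↦ by cases c <;> rfl)
        right_inv := fun _ ↦ rfl }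
    rw [Nat.card_congr e, Nat.card_sigma, Finset.sum_congr rfl fun f' _ ↦ hT b f']
    simp [Fintype.card_embedding_eq]
  have hsum : Nat.card {p : A × (Fin d ↪ Fin n) // S p.1 a fun i j ↦ p.2 i = f j} =
      ∑ b, Nat.card (T b f) := by
    rw [← Nat.card_sigma]
    exact Nat.card_congr
      { toFun := fun p ↦ ⟨p.1.1, p.1.2, p.2⟩
        invFun := fun x ↦ ⟨(x.1, x.2.1), x.2.2⟩
        left_inv := fun _ ↦ rfl
        right_inv := fun _ ↦ rfl }
  have hn : (n.descFactorial d : ℚ) ≠ 0 := by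
    have : n.descFactorial d = Fintype.card (Fin d ↪ Fin n) := by
      simp [Fintype.card_embedding_eq]
    rw [this]
    have : Nonempty (Fin d ↪ Fin n) := ⟨f⟩
    exact_mod_cast Fintype.card_ne_zero
  simp only [hpairs, hsum, Nat.cast_mul, Nat.cast_sum, ← Finset.mul_sum]
  field_simp

/-- Suppose that the elements of `V n` are represented by labelled embeddings `[d] ↪ [n]`, and that,
for large `n`, equality and a relation `r` on `V n` are read off from the labels and the
coincidences of the representatives. Then the number of maps from a finite set to `V n` with prescribed
conditions on equality and `r` is eventually a rational function of `n`. -/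
theorem IsEventuallyRational.card_maps {A : Type*} [Finite A] {d : ℕ} {V : ℕ → Type*}
    [∀ n, Finite (V n)] (π : ∀ n, A × (Fin d ↪ Fin n) → V n)
    (hπ : ∀ᶠ n in Filter.atTop, Function.Surjective (π n)) (r : ∀ n, V n → V n → Prop)
    (S T : A → A → (Fin d → Fin d → Prop) → Prop)
    (hS : ∀ᶠ n in Filter.atTop, ∀ a f b g, π n (a, f) = π n (b, g) ↔ S a b fun i j ↦ f i = g j)
    (hT : ∀ᶠ n in Filter.atTop, ∀ a f b g,
      r n (π n (a, f)) (π n (b, g)) ↔ T a b fun i j ↦ f i = g j)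
    {W : Type*} [Finite W] (Q : (W → W → Prop) → (W → W → Prop) → Prop) :
    IsEventuallyRational fun n ↦ (Nat.card {φ : W → V n //
      Q (fun w w' ↦ φ w = φ w') fun w w' ↦ r n (φ w) (φ w')} : ℚ) := by
  classical
  have := Fintype.ofFinite A
  have := Fintype.ofFinite W
  -- The number of pairs representing the same element as a pair with label `a`.
  let K (a : A) (n : ℕ) : ℚ := (∑ b, (Nat.card {F : Bool → (Fin d ↪ Fin n) //
    S b a fun i j ↦ F true i = F false j} : ℚ)) * (n.descFactorial d : ℚ)⁻¹
  have hK (a : A) : IsEventuallyRational (K a) :=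
    (IsEventuallyRational.sum _ fun b _ ↦ card_embedding_family d
      fun P ↦ S b a (P true false)).mul (descFactorial d).inv
  -- The number of admissible families of pairs with labels `a`.
  let N (a : W → A) (n : ℕ) : ℕ := Nat.card {F : W → (Fin d ↪ Fin n) //
    Q (fun w w' ↦ S (a w) (a w') fun i j ↦ F w i = F w' j)
      fun w w' ↦ T (a w) (a w') fun i j ↦ F w i = F w' j}
  have hN (a : W → A) : IsEventuallyRational fun n ↦ (N a n : ℚ) :=
    card_embedding_family d fun P ↦ Q (fun w w' ↦ S (a w) (a w') (P w w'))
      fun w w' ↦ T (a w) (a w') (P w w')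
  refine (IsEventuallyRational.sum Finset.univ fun (a : W → A) _ ↦
    (hN a).mul (.prod Finset.univ fun w _ ↦ (hK (a w)).inv)).congr ?_
  filter_upwards [hπ, hS, hT] with n hπn hSn hTn
  have hfib (a : A) (f : Fin d ↪ Fin n) :
      (Nat.card {p // π n p = π n (a, f)} : ℚ) = K a n := by
    refine Eq.trans ?_ (Nat.card_coincidences_eq_div S a f)
    congr 1
    exact Nat.card_congr (Equiv.subtypeEquivRight fun p ↦ hSn p.1 p.2 a f)
  rw [Nat.card_subtype_eq_sum_lifts hπn, ← (Equiv.arrowProdEquivProdArrow W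
    (fun _ ↦ A) fun _ ↦ Fin d ↪ Fin n).symm.sum_comp, Fintype.sum_prod_type]
  refine Finset.sum_congr rfl fun a _ ↦ ?_
  have hterm (F : W → (Fin d ↪ Fin n)) (w : W) :
      ((Equiv.arrowProdEquivProdArrow W (fun _ ↦ A) fun _ ↦ Fin d ↪ Fin n).symm (a, F)) w =
        (a w, F w) := rfl
  simp only [Function.comp_apply, hterm, hfib]
  simp only [hSn, hTn]
  rw [← Finset.sum_filter, Finset.sum_const, nsmul_eq_mul, ← Fintype.card_subtype,
    ← Nat.card_eq_fintype_card]

/-! ### Labelled and unlabelled copies -/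

namespace SimpleGraph

variable {V : Type*} {W : Type*} {G : SimpleGraph V} {H : SimpleGraph W}

/-- A labelled copy of `H` is a subgraph together with an isomorphism from `H` onto it, and the
isomorphisms onto a given subgraph are in bijection with the automorphisms of `H`. -/
theorem card_copy_eq_ncard_mul_card_aut (P : G.Subgraph → Prop) :
    Nat.card {c : Copy H G // P c.toSubgraph} =
      {G' : G.Subgraph | P G' ∧ Nonempty (H ≃g G'.coe)}.ncard * Nat.card (H ≃g H) := by
  let c (G' : G.Subgraph) (e : H ≃g G'.coe) : Copy H G :=
    ⟨G'.hom.comp e.toHom, Subgraph.hom_injective.comp e.injective⟩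
  have hc (G' : G.Subgraph) (e : H ≃g G'.coe) : (c G' e).toSubgraph = G' := by
    simp [c, Copy.toSubgraph, Subgraph.map_comp]
  let toCopy : (Σ G' : {G' : G.Subgraph // P G' ∧ Nonempty (H ≃g G'.coe)}, H ≃g G'.1.coe) →
      {c : Copy H G // P c.toSubgraph} :=
    fun x ↦ ⟨c x.1.1 x.2, by rw [hc]; exact x.1.2.1⟩
  have hbij : Function.Bijective toCopy := by
    constructor
    · rintro ⟨⟨G₁, h₁⟩, e₁⟩ ⟨⟨G₂, h₂⟩, e₂⟩ h
      have h' : c G₁ e₁ = c G₂ e₂ := congrArg Subtype.val h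
      obtain rfl : G₁ = G₂ := by rw [← hc G₁ e₁, h', hc]
      obtain rfl : e₁ = e₂ := by
        ext w
        exact DFunLike.congr_fun h' w
      rfl
    · rintro ⟨c, hc⟩
      exact ⟨⟨⟨c.toSubgraph, hc, ⟨c.isoToSubgraph⟩⟩, c.isoToSubgraph⟩, rfl⟩
  rw [← Nat.card_congr (Equiv.ofBijective toCopy hbij)]
  have e : (Σ G' : {G' : G.Subgraph // P G' ∧ Nonempty (H ≃g G'.coe)}, H ≃g G'.1.coe) ≃
      {G' : G.Subgraph // P G' ∧ Nonempty (H ≃g G'.coe)} × (H ≃g H) :=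
    (Equiv.sigmaCongrRight fun G' ↦
      { toFun := fun e ↦ e.trans G'.2.2.some.symm
        invFun := fun e ↦ e.trans G'.2.2.some
        left_inv := fun e ↦ by ext; simp
        right_inv := fun e ↦ by ext; simp }).trans (Equiv.sigmaEquivProd _ _)
  rw [Nat.card_congr e, Nat.card_prod]
  rfl

/-- Labelled copies satisfying a condition `P` are the injective maps on vertices that preserve
adjacency and satisfy `P`. -/
def copyEquivSubtype (P : (W → V) → Prop) :
    {c : Copy H G // P c} ≃ {φ : W → V // (∀ w w', φ w = φ w' → w = w') ∧
      (∀ w w', H.Adj w w' → G.Adj (φ w) (φ w')) ∧ P φ} where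
  toFun c := ⟨c.1, fun _ _ h ↦ c.1.injective h, fun _ _ h ↦ c.1.toHom.map_adj h, c.2⟩
  invFun φ := ⟨⟨⟨φ.1, fun h ↦ φ.2.2.1 _ _ h⟩, fun w w' h ↦ φ.2.1 w w' h⟩, φ.2.2.2⟩
  left_inv _ := rfl
  right_inv _ := rfl

theorem Copy.isInduced_toSubgraph_iff (c : Copy H G) :
    c.toSubgraph.IsInduced ↔ ∀ w w', G.Adj (c w) (c w') → H.Adj w w' := by
  have hadj (w w' : W) : c.toSubgraph.Adj (c w) (c w') ↔ H.Adj w w' := by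
    simp only [Copy.toSubgraph, Subgraph.map_adj]
    exact Relation.map_apply_apply c.injective c.injective _ _ _
  have hverts (v : V) : v ∈ c.toSubgraph.verts ↔ ∃ w, c w = v := by
    simp [Copy.toSubgraph]
  constructor
  · intro h w w' hw
    exact (hadj w w').1 (h ((hverts _).2 ⟨w, rfl⟩) ((hverts _).2 ⟨w', rfl⟩) hw)
  · intro h v hv v' hv' hvv'
    obtain ⟨w, rfl⟩ := (hverts _).1 hv
    obtain ⟨w', rfl⟩ := (hverts _).1 hv'
    exact (hadj w w').2 (h w w' hvv')

variable (G H)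

theorem copyCount_mul_card_aut [Fintype V] :
    G.copyCount H * Nat.card (H ≃g H) = Nat.card {φ : W → V //
      (∀ w w', φ w = φ w' → w = w') ∧ ∀ w w', H.Adj w w' → G.Adj (φ w) (φ w')} := by
  classical
  have h := card_copy_eq_ncard_mul_card_aut (G := G) (H := H) fun _ ↦ True
  have hcount : G.copyCount H = {G' : G.Subgraph | True ∧ Nonempty (H ≃g G'.coe)}.ncard := by
    simp only [true_and, copyCount]
    rw [Set.ncard_eq_toFinset_card', Set.toFinset_ofPred]
  rw [hcount, ← h, Nat.card_congr (copyEquivSubtype fun _ ↦ True)]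
  simp

theorem inducedCopyCount_mul_card_aut :
    G.inducedCopyCount H * Nat.card (H ≃g H) = Nat.card {φ : W → V //
      (∀ w w', φ w = φ w' → w = w') ∧ (∀ w w', H.Adj w w' → G.Adj (φ w) (φ w')) ∧
        ∀ w w', G.Adj (φ w) (φ w') → H.Adj w w'} := by
  rw [inducedCopyCount, ← card_copy_eq_ncard_mul_card_aut Subgraph.IsInduced,
    ← Nat.card_congr (copyEquivSubtype fun φ ↦ ∀ w w', G.Adj (φ w) (φ w') → H.Adj w w')]
  exact Nat.card_congr (Equiv.subtypeEquivRight fun c ↦ c.isInduced_toSubgraph_iff)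

end SimpleGraph

/-! ### Vertex-stable `FI`-graphs -/

namespace FIGraph

variable (G : FIGraph.{u})

theorem transition_trans {l m n : ℕ} (f : Fin l ↪ Fin m) (g : Fin m ↪ Fin n)
    (v : (G.eval l).V) :
    G.transition (f.trans g) v = G.transition g (G.transition f v) := by
  have h : G.transition (f.trans g) = (G.transition g).comp (G.transition f) :=
    G.map_comp (X := FI.of l) (Y := FI.of m) (Z := FI.of n) f g
  rw [h]
  rfl

theorem transition_refl {n : ℕ} (v : (G.eval n).V) :
    G.transition (Function.Embedding.refl (Fin n)) v = v := by
  have h : G.transition (Function.Embedding.refl (Fin n)) = SimpleGraph.Hom.id :=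
    G.map_id (FI.of n)
  rw [h]
  rfl

variable {G} {d : ℕ}

theorem IsVertexStable.exists_transition_eq (hG : G.IsVertexStable d) {n : ℕ} (hn : d ≤ n)
    (v : (G.eval n).V) : ∃ (w : (G.eval d).V) (f : Fin d ↪ Fin n), G.transition f w = v := by
  induction n, hn using Nat.le_induction with
  | base => exact ⟨v, .refl _, G.transition_refl v⟩
  | succ n hn ih =>
    obtain ⟨w, g, rfl⟩ := hG n hn v
    obtain ⟨w, f, rfl⟩ := ih w
    exact ⟨w, f.trans g, G.transition_trans f g w⟩

theorem IsVertexStable.card_vertices_le (hG : G.IsVertexStable d) {n : ℕ} (hn : d ≤ n) :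
    Nat.card (G.eval n).V ≤ Nat.card (G.eval d).V * n ^ d := by
  have hsurj : Function.Surjective fun p : (G.eval d).V × (Fin d ↪ Fin n) ↦
      (G.transition p.2 p.1 : (G.eval n).V) := fun v ↦ by
    obtain ⟨w, f, h⟩ := hG.exists_transition_eq hn v
    exact ⟨(w, f), h⟩
  refine (Nat.card_le_card_of_surjective _ hsurj).trans ?_
  rw [Nat.card_prod, Nat.card_eq_fintype_card (α := Fin d ↪ Fin n), Fintype.card_embedding_eq,
    Fintype.card_fin, Fintype.card_fin]
  exact Nat.mul_le_mul_left _ (Nat.descFactorial_le_pow n d)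

/-- The number of maps from a finite set to the vertices of `G_n`, subject to a condition on the
equalities and adjacencies among the values, is eventually a rational function of `n`. -/
theorem IsVertexStable.isEventuallyRational_card_maps (hG : G.IsVertexStable d)
    {W : Type*} [Finite W] (Q : (W → W → Prop) → (W → W → Prop) → Prop) :
    IsEventuallyRational fun n ↦ (Nat.card {φ : W → (G.eval n).V //
      Q (fun w w' ↦ φ w = φ w') fun w w' ↦ (G.eval n).graph.Adj (φ w) (φ w')} : ℚ) := by
  let π (n : ℕ) (p : (G.eval d).V × (Fin d ↪ Fin n)) : (G.eval n).V := G.transition p.2 p.1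
  obtain ⟨S, hS⟩ := exists_eventually_iff_coincidences (A := (G.eval d).V) (d := d)
    (fun n a f b g ↦ π n (a, f) = π n (b, g)) fun h a f b g hab ↦ by
      simp only [π, transition_trans] at hab ⊢
      rw [hab]
  obtain ⟨T, hT⟩ := exists_eventually_iff_coincidences (A := (G.eval d).V) (d := d)
    (fun n a f b g ↦ (G.eval n).graph.Adj (π n (a, f)) (π n (b, g))) fun h a f b g hab ↦ by
      simp only [π, transition_trans] at hab ⊢
      exact (G.transition h).map_adj hab
  refine IsEventuallyRational.card_maps π ?_ (fun n ↦ (G.eval n).graph.Adj) S T hS hT Q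
  filter_upwards [Filter.eventually_ge_atTop d] with n hn v
  obtain ⟨w, f, h⟩ := hG.exists_transition_eq hn v
  exact ⟨(w, f), h⟩

/-- If a positive multiple `c n * k` counts the maps from a finite set to the vertices of `G_n`
subject to a condition on equalities and adjacencies, then `c` is eventually a polynomial, whose
degree is bounded by the growth of the number of all maps. -/
theorem IsVertexStable.exists_polynomial (hG : G.IsVertexStable d) {W : Type*} [Fintype W]
    (Q : (W → W → Prop) → (W → W → Prop) → Prop) {k : ℕ} (hk : k ≠ 0) {c : ℕ → ℕ}
    (hc : ∀ n, c n * k = Nat.card {φ : W → (G.eval n).V //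
      Q (fun w w' ↦ φ w = φ w') fun w w' ↦ (G.eval n).graph.Adj (φ w) (φ w')}) :
    ∃ p : Polynomial ℚ, p.natDegree ≤ d * Fintype.card W ∧
      ∀ᶠ n : ℕ in Filter.atTop, p.eval (n : ℚ) = c n := by
  have hrat : IsEventuallyRational fun n ↦ (c n : ℚ) := by
    refine ((hG.isEventuallyRational_card_maps Q).mul (.const (k : ℚ)⁻¹)).congr
      (.of_forall fun n ↦ ?_)
    rw [← hc n, Nat.cast_mul, mul_assoc, mul_inv_cancel₀ (by exact_mod_cast hk), mul_one]
  obtain ⟨p, hp⟩ := hrat.exists_polynomial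
  refine ⟨p, Polynomial.natDegree_le_of_eventually_abs_eval_le
    ((Nat.card (G.eval d).V : ℚ) ^ Fintype.card W) ?_, hp⟩
  filter_upwards [hp, Filter.eventually_ge_atTop d] with n hpn hn
  have hle : c n ≤ (Nat.card (G.eval d).V * n ^ d) ^ Fintype.card W :=
    calc c n ≤ c n * k := Nat.le_mul_of_pos_right _ (Nat.pos_of_ne_zero hk)
      _ ≤ Nat.card (W → (G.eval n).V) := by
        rw [hc n]
        exact Nat.card_le_card_of_injective _ Subtype.val_injective
      _ = Nat.card (G.eval n).V ^ Fintype.card W := by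
        rw [Nat.card_fun, Nat.card_eq_fintype_card (α := W)]
      _ ≤ _ := Nat.pow_le_pow_left (hG.card_vertices_le hn) _
  rw [hpn, Nat.abs_cast, pow_mul, ← mul_pow]
  exact_mod_cast hle

end FIGraph

theorem mainTheorem2 (G : FIGraph.{u}) (d : ℕ) (hG : G.IsVertexStable d)
    {W : Type v} [Fintype W] (H : SimpleGraph W) :
    (∃ p : Polynomial ℚ, p.natDegree ≤ d * Fintype.card W ∧
      ∀ᶠ n : ℕ in Filter.atTop,
        p.eval (n : ℚ) = ((G.eval n).graph.copyCount H : ℚ)) ∧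
    (∃ p : Polynomial ℚ, p.natDegree ≤ d * Fintype.card W ∧
      ∀ᶠ n : ℕ in Filter.atTop,
        p.eval (n : ℚ) = ((G.eval n).graph.inducedCopyCount H : ℚ)) := by
  have : Finite (H ≃g H) := Finite.of_injective _ DFunLike.coe_injective
  have hk : Nat.card (H ≃g H) ≠ 0 := Nat.card_ne_zero.2 ⟨⟨RelIso.refl _⟩, this⟩
  exact ⟨hG.exists_polynomial
      (fun e r ↦ (∀ w w', e w w' → w = w') ∧ ∀ w w', H.Adj w w' → r w w') hk
      fun n ↦ (G.eval n).graph.copyCount_mul_card_aut H,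
    hG.exists_polynomial
      (fun e r ↦ (∀ w w', e w w' → w = w') ∧ (∀ w w', H.Adj w w' → r w w') ∧
        ∀ w w', r w w' → H.Adj w w') hk
      fun n ↦ (G.eval n).graph.inducedCopyCount_mul_card_aut H⟩
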